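/- Let $M$ be a connected smooth manifold (finite-dimensional, Hausdorff, without boundary), let $x,y\in M$, and let $U\subseteq M$ be a connected open set containing $x$ and $y$. Then there are finitely many smooth vector fields $X_1,\dots,X_k$ on $M$, each having compact support contained in $U$, such that their (globally defined) flows $\varphi_i^t$ satisfy $$\varphi_k^1\circ\cdots\circ\varphi_2^1\circ\varphi_1^1(x)=y .$$ Moreover, the map $\Phi=\varphi_k^1\circ\cdots\circ\varphi_1^1\colon M\to M$ is a smooth diffeomorphism with $\Phi(x)=y$ and $\Phi(m)=m$ for all $m\in M\setminus U$. In particular, there is a diffeomorphism of $M$ that sends $x$ to $y$ and is the identity outside $U$. -/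

import Mathlib

open scoped Manifold ContDiff

/-- A vector field `X` on the manifold `M` that is smooth and whose support, the closure of
`{p | X p ≠ 0}` in `M`, is compact and contained in `U`. -/
structure IsSmoothCompactlySupportedIn {E : Type*} [NormedAddCommGroup E] [NormedSpace ℝ E]
    {M : Type*} [TopologicalSpace M] [ChartedSpace E M] [IsManifold 𝓘(ℝ, E) ∞ M]
    (X : (p : M) → TangentSpace 𝓘(ℝ, E) p) (U : Set M) : Prop where
  smooth : ContMDiff 𝓘(ℝ, E) 𝓘(ℝ, E).tangent ∞
    (fun p => (⟨p, X p⟩ : TangentBundle 𝓘(ℝ, E) M))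
  isCompact_support : IsCompact (closure {p : M | X p ≠ 0})
  support_subset : closure {p : M | X p ≠ 0} ⊆ U

/-- `φ` is the (globally defined) flow of the vector field `X`: for every point `p`, the curve
`t ↦ φ t p` is defined for all times, is an integral curve of `X`, and starts at `p`. -/
structure IsFlowOf {E : Type*} [NormedAddCommGroup E] [NormedSpace ℝ E]
    {M : Type*} [TopologicalSpace M] [ChartedSpace E M] [IsManifold 𝓘(ℝ, E) ∞ M]
    (φ : ℝ → M → M) (X : (p : M) → TangentSpace 𝓘(ℝ, E) p) : Prop where
  map_zero : ∀ p : M, φ 0 p = p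
  isMIntegralCurve : ∀ p : M, IsMIntegralCurve (I := 𝓘(ℝ, E)) (fun t => φ t p) X

/-- The composition `f (k - 1) ∘ ⋯ ∘ f 1 ∘ f 0` (so `f 0` is applied first); it is the identity
for `k = 0`. -/
def composeMaps {M : Type*} : (k : ℕ) → (Fin k → M → M) → M → M
  | 0, _ => id
  | k + 1, f => f (Fin.last k) ∘ composeMaps k (fun i => f i.castSucc)

/-!
Mathlib has existence and uniqueness of integral curves, but not the smooth dependence of a flow on
its initial point. The proof avoids the general theorem: one is free to choose the vector fields,
and a very special kind suffices, whose flows reduce to a flow on the line.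

On the line, let `b` be smooth with compact support and let `β` be its global flow. The difference
of two solutions satisfies a scalar linear equation, whence the closed formula
`β t x - β t y = (x - y) * exp (∫ s in 0..t, ∫ r in 0..1, b' (β s y + r * (β s x - β s y)))`
(`sub_eq_sub_mul_exp_of_hasDerivAt`). It gives the joint continuity of `β` and then
`∂β/∂x = exp (∫ s in 0..t, b' (β s x))`; together with `∂β/∂t = b (β t x)` this shows by induction
that `β` is jointly `C^n` for all `n` (`lineFlow_contDiff`).

In a finite-dimensional space, split off a unit vector `u` by a functional `l` of norm one with
`l u = 1`: every `z` is `z₀ + w + s • u` with `l w = 0`. For bump functions `f` and `b` the field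
`(τ * f w * b s) • u` has compact support and the explicit flow
`(w, s) ↦ (w, β (t * τ * f w) s)`, which is smooth since `β` is. As `b = 1` near `0`, its time-one
map carries `z₀` to `z₀ + τ • u` for small `τ` (`exists_smoothFlow_map_eq`).

A field with compact support in the target of a chart, and its flow, can be carried to the manifold
and extended by zero, respectively by the identity. Hence each point of `U` has a neighbourhood all
of whose points can be joined to it, in both directions, by one such flow
(`eventually_flowMapsTo`), and connectedness of `U` makes the generated relation total on `U`.
-/

/-! ### Integrals depending on a parameter -/

theorem hasFDerivAt_integral_zero_one {H F : Type*} [NormedAddCommGroup H] [NormedSpace ℝ H]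
    [ProperSpace H] [NormedAddCommGroup F] [NormedSpace ℝ F]
    {g : H → ℝ → F} {g' : H → ℝ → H →L[ℝ] F} (hg : Continuous (Function.uncurry g))
    (hg' : Continuous (Function.uncurry g')) (hd : ∀ p r, HasFDerivAt (fun p => g p r) (g' p r) p)
    (p : H) : HasFDerivAt (fun p => ∫ r in (0:ℝ)..1, g p r) (∫ r in (0:ℝ)..1, g' p r) p := by
  obtain ⟨C, hC⟩ : ∃ C, ∀ z ∈ Metric.closedBall p 1 ×ˢ Set.Icc (0:ℝ) 1,
      ‖Function.uncurry g' z‖ ≤ C :=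
    ((isCompact_closedBall p 1).prod isCompact_Icc).exists_bound_of_continuousOn hg'.continuousOn
  refine intervalIntegral.hasFDerivAt_integral_of_dominated_of_fderiv_le (bound := fun _ => C)
    (Metric.closedBall_mem_nhds p one_pos) ?_ ?_ ?_ ?_ ?_ ?_
  · exact .of_forall fun x => (hg.uncurry_left x).aestronglyMeasurable
  · exact (hg.uncurry_left p).intervalIntegrable _ _
  · exact (hg'.uncurry_left p).aestronglyMeasurable
  · refine .of_forall fun t ht x hx => hC (x, t) ⟨hx, ?_⟩
    rw [Set.uIoc_of_le zero_le_one] at ht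
    exact Set.Ioc_subset_Icc_self ht
  · exact intervalIntegrable_const
  · exact .of_forall fun t _ x _ => hd x t

/-- The integrand is scalar: in the induction on `n`, only the directional derivatives of the
integral are needed, since the parameter space is finite-dimensional. -/
theorem contDiff_integral_zero_one {H : Type*} [NormedAddCommGroup H] [NormedSpace ℝ H]
    [FiniteDimensional ℝ H] (n : ℕ) {g : H → ℝ → ℝ}
    (hg : ContDiff ℝ n (Function.uncurry g)) : ContDiff ℝ n (fun p => ∫ r in (0:ℝ)..1, g p r) := by
  have : ProperSpace H := FiniteDimensional.proper_real H
  induction n generalizing g with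
  | zero =>
    rw [Nat.cast_zero, contDiff_zero] at *
    exact intervalIntegral.continuous_parametric_intervalIntegral_of_continuous' hg 0 1
  | succ n ih =>
    rw [Nat.cast_succ] at hg
    have hd := (contDiff_succ_iff_fderiv.1 hg)
    set g' : H → ℝ → H →L[ℝ] ℝ := fun p r =>
      (fderiv ℝ (Function.uncurry g) (p, r)).comp (ContinuousLinearMap.inl ℝ H ℝ)
    have hg' : ContDiff ℝ n (Function.uncurry g') := hd.2.2.clm_comp contDiff_const
    have hD : ∀ p, HasFDerivAt (fun p => ∫ r in (0:ℝ)..1, g p r)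
        (∫ r in (0:ℝ)..1, g' p r) p := by
      refine hasFDerivAt_integral_zero_one hg.continuous hg'.continuous fun p r => ?_
      exact (hd.1 (p, r)).hasFDerivAt.comp (f := fun e => (e, r)) p (hasFDerivAt_prodMk_left p r)
    rw [Nat.cast_succ, contDiff_succ_iff_fderiv_apply]
    refine ⟨fun p => (hD p).differentiableAt, by simp, fun y => ?_⟩
    have : (fun p => fderiv ℝ (fun p => ∫ r in (0:ℝ)..1, g p r) p y)
        = fun p => ∫ r in (0:ℝ)..1, g' p r y := by
      ext p
      rw [(hD p).fderiv, ContinuousLinearMap.intervalIntegral_apply]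
      exact (hg'.continuous.uncurry_left p).intervalIntegrable _ _
    rw [this]
    exact ih (hg'.clm_apply contDiff_const)

/-! ### Flows of compactly supported fields on the line -/

theorem exists_lineFlow {b : ℝ → ℝ} (hb : ContDiff ℝ ∞ b) (hs : HasCompactSupport b) :
    ∃ β : ℝ → ℝ → ℝ, (∀ x, β 0 x = x) ∧ ∀ t x, HasDerivAt (fun t => β t x) (b (β t x)) t := by
  obtain ⟨C, hC⟩ := hb.continuous.bounded_above_of_compact_support hs
  obtain ⟨K, hK⟩ := hb.lipschitzWith_of_hasCompactSupport hs (by simp)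
  have key : ∀ x : ℝ, ∃ γ : ℝ → ℝ, γ 0 = x ∧ IsMIntegralCurve (I := 𝓘(ℝ, ℝ)) γ
      (fun x => (b x : TangentSpace 𝓘(ℝ, ℝ) x)) := by
    apply exists_isMIntegralCurve_of_isMIntegralCurveOn (ε := 1) _ one_pos
    · intro x
      have hP : IsPicardLindelof (fun _ => b) (tmin := -1) (tmax := 1) ⟨0, by simp⟩ x C.toNNReal 0
          C.toNNReal K := by
        apply IsPicardLindelof.of_time_independent
        · exact fun y _ => (hC y).trans (Real.le_coe_toNNReal C)
        · exact hK.lipschitzOnWith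
        · simp
      obtain ⟨α, h0, hα⟩ := hP.exists_eq_forall_mem_Icc_hasDerivWithinAt₀
      refine ⟨α, h0, fun t ht => ?_⟩
      have := (hα t (Set.Ioo_subset_Icc_self ht)).mono Set.Ioo_subset_Icc_self
      exact this.hasFDerivWithinAt.hasMFDerivWithinAt
    · exact contMDiff_vectorSpace_iff_contDiff.2 (hb.of_le (by simp))
  choose γ h0 hγ using key
  refine ⟨fun t x => γ x t, h0, fun t x => ?_⟩
  have h : HasFDerivAt (γ x) ((1 : ℝ →L[ℝ] ℝ).smulRight (b (γ x t))) t :=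
    hasMFDerivAt_iff_hasFDerivAt.1 (hγ x t)
  simpa using h.hasDerivAt

theorem lineFlow_unique {b : ℝ → ℝ} (hb : ContDiff ℝ ∞ b) (hs : HasCompactSupport b) {f g : ℝ → ℝ}
    (hf : ∀ t, HasDerivAt f (b (f t)) t) (hg : ∀ t, HasDerivAt g (b (g t)) t) {t₀ : ℝ}
    (h : f t₀ = g t₀) : f = g := by
  obtain ⟨K, hK⟩ := hb.lipschitzWith_of_hasCompactSupport hs (by simp)
  exact ODE_solution_unique_univ (v := fun _ => b) (s := fun _ => Set.univ) (K := K)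
    (fun _ => hK.lipschitzOnWith) (fun t => ⟨hf t, trivial⟩) (fun t => ⟨hg t, trivial⟩) h

theorem sub_eq_integral_deriv_mul_sub {b : ℝ → ℝ} (hb : ContDiff ℝ ∞ b) (u v : ℝ) :
    b u - b v = (∫ r in (0:ℝ)..1, deriv b (v + r * (u - v))) * (u - v) := by
  have h1 : ∀ r : ℝ, HasDerivAt (fun r => b (v + r * (u - v)))
      (deriv b (v + r * (u - v)) * (u - v)) r := by
    intro r
    have h := (hb.differentiable (by simp) (v + r * (u - v))).hasDerivAt
    exact h.comp r (by simpa using ((hasDerivAt_id r).mul_const (u - v)).const_add v)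
  have := intervalIntegral.integral_eq_sub_of_hasDerivAt (fun r _ => h1 r)
    (a := 0) (b := 1) (Continuous.intervalIntegrable (by
      have := hb.continuous_deriv (by simp); fun_prop) _ _)
  simp at this
  rw [← this]

/-- The difference of two solutions of `x' = b x` on the line solves a linear scalar equation, whose
coefficient is the difference quotient of `b` written as an integral, so that it is continuous. -/
theorem sub_eq_sub_mul_exp_of_hasDerivAt {b : ℝ → ℝ} (hb : ContDiff ℝ ∞ b) {f g : ℝ → ℝ}
    (hf : ∀ t, HasDerivAt f (b (f t)) t) (hg : ∀ t, HasDerivAt g (b (g t)) t) (t : ℝ) :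
    f t - g t = (f 0 - g 0) *
      Real.exp (∫ s in (0:ℝ)..t, ∫ r in (0:ℝ)..1, deriv b (g s + r * (f s - g s))) := by
  have hfc : Continuous f := continuous_iff_continuousAt.2 fun t => (hf t).continuousAt
  have hgc : Continuous g := continuous_iff_continuousAt.2 fun t => (hg t).continuousAt
  have hbc : Continuous (deriv b) := hb.continuous_deriv (by simp)
  set q : ℝ → ℝ := fun s => ∫ r in (0:ℝ)..1, deriv b (g s + r * (f s - g s))
  have hq : Continuous q :=
    intervalIntegral.continuous_parametric_intervalIntegral_of_continuous' (by fun_prop) 0 1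
  have hQ : ∀ t, HasDerivAt (fun t => ∫ s in (0:ℝ)..t, q s) (q t) t := fun t =>
    intervalIntegral.integral_hasDerivAt_right (hq.intervalIntegrable _ _)
      (hq.stronglyMeasurableAtFilter _ _) hq.continuousAt
  have hc : ∀ t, HasDerivAt (fun t => (f t - g t) * Real.exp (-∫ s in (0:ℝ)..t, q s)) 0 t := by
    intro t
    refine (((hf t).sub (hg t)).mul (hQ t).neg.exp).congr_deriv ?_
    rw [Pi.sub_apply, sub_eq_integral_deriv_mul_sub hb]
    ring
  have := is_const_of_deriv_eq_zero (fun t => (hc t).differentiableAt) (fun t => (hc t).deriv) t 0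
  simp only [intervalIntegral.integral_same, neg_zero, Real.exp_zero, mul_one] at this
  rw [← this, mul_assoc, ← Real.exp_add]
  simp

theorem lineFlow_continuous {b : ℝ → ℝ} (hb : ContDiff ℝ ∞ b) (hs : HasCompactSupport b)
    {β : ℝ → ℝ → ℝ} (h0 : ∀ x, β 0 x = x) (hβ : ∀ t x, HasDerivAt (fun t => β t x) (b (β t x)) t) :
    Continuous (Function.uncurry β) := by
  obtain ⟨C, hC⟩ := (hb.continuous_deriv (by simp)).bounded_above_of_compact_support hs.deriv
  have hC0 : 0 ≤ C := (norm_nonneg _).trans (hC 0)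
  -- On a bounded time interval, the exponential factor bounds the Lipschitz constants of `β t`.
  have hLip : ∀ T t, |t| ≤ T → LipschitzWith (Real.exp (C * T)).toNNReal (β t) := by
    intro T t hT
    refine LipschitzWith.of_dist_le_mul fun x y => ?_
    rw [Real.coe_toNNReal _ (Real.exp_pos _).le, Real.dist_eq, Real.dist_eq,
      sub_eq_sub_mul_exp_of_hasDerivAt hb (fun t => hβ t x) (fun t => hβ t y) t, abs_mul, h0, h0,
      mul_comm, Real.abs_exp]
    gcongr
    refine (le_abs_self _).trans ?_
    rw [← Real.norm_eq_abs]
    refine (intervalIntegral.norm_integral_le_of_norm_le_const (C := C) fun s _ => ?_).trans ?_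
    · refine (intervalIntegral.norm_integral_le_of_norm_le_const (C := C) fun s _ => hC _).trans ?_
      simp
    · rw [sub_zero]
      gcongr
  have hcont : ∀ x, Continuous fun t => β t x := fun x =>
    continuous_iff_continuousAt.2 fun t => (hβ t x).continuousAt
  rw [continuous_iff_continuousAt]
  rintro ⟨t, x⟩
  have := continuousOn_prod_of_continuousOn_lipschitzOnWith'
    (s := Metric.ball 0 (|t| + 1)) (t := Set.univ) (Function.uncurry β)
    (Real.exp (C * (|t| + 1))).toNNReal
    (fun s hs => (hLip (|t| + 1) s (by simpa using (mem_ball_zero_iff.1 hs).le)).lipschitzOnWith)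
    (fun x _ => (hcont x).continuousOn)
  refine this.continuousAt (prod_mem_nhds (Metric.isOpen_ball.mem_nhds (by simp)) Filter.univ_mem)

/-- The global flow of a smooth compactly supported field on the line is smooth in time and initial
point jointly. -/
theorem lineFlow_contDiff {b : ℝ → ℝ} (hb : ContDiff ℝ ∞ b) (hs : HasCompactSupport b)
    {β : ℝ → ℝ → ℝ} (h0 : ∀ x, β 0 x = x) (hβ : ∀ t x, HasDerivAt (fun t => β t x) (b (β t x)) t) :
    ContDiff ℝ ∞ (Function.uncurry β) := by
  have hbc : Continuous (deriv b) := hb.continuous_deriv (by simp)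
  have hb' : ContDiff ℝ ∞ (deriv b) := (contDiff_infty_iff_deriv.1 hb).2
  have hc := lineFlow_continuous hb hs h0 hβ
  -- `J` is the derivative of the flow in the initial point. The integral of `b' (β s x)` over
  -- `[0, t]` is rescaled to `[0, 1]` to make its smoothness in `t` that of a parametric integral.
  set J : ℝ → ℝ → ℝ := fun t x => Real.exp (t * ∫ r in (0:ℝ)..1, deriv b (β (r * t) x)) with hJ
  have hJn : ∀ n : ℕ, ContDiff ℝ n (Function.uncurry β) → ContDiff ℝ n (Function.uncurry J) := by
    intro n hn
    have h1 : ContDiff ℝ n (fun p : ℝ × ℝ => ∫ r in (0:ℝ)..1, deriv b (β (r * p.1) p.2)) := by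
      refine contDiff_integral_zero_one n (g := fun (p : ℝ × ℝ) r => deriv b (β (r * p.1) p.2)) ?_
      refine (hb'.of_le (mod_cast le_top)).comp
        (hn.comp (f := fun q : (ℝ × ℝ) × ℝ => (q.2 * q.1.1, q.1.2)) ?_)
      fun_prop
    exact (contDiff_fst.mul h1).exp
  have hx : ∀ t x, HasDerivAt (β t) (J t x) x := by
    intro t x
    -- The slope at `y ≠ x` is the exponential factor, which is continuous up to `y = x`.
    rw [hasDerivAt_iff_tendsto_slope]
    have hE : Continuous fun y => Real.exp (∫ s in (0:ℝ)..t, ∫ r in (0:ℝ)..1,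
        deriv b (β s x + r * (β s y - β s x))) := by
      refine Real.continuous_exp.comp ?_
      refine intervalIntegral.continuous_parametric_intervalIntegral_of_continuous' ?_ 0 t
      refine intervalIntegral.continuous_parametric_intervalIntegral_of_continuous'
        (f := fun (p : ℝ × ℝ) r => deriv b (β p.2 x + r * (β p.2 p.1 - β p.2 x))) ?_ 0 1
      have h1 : Continuous fun q : (ℝ × ℝ) × ℝ => β q.1.2 x :=
        hc.comp (f := fun q : (ℝ × ℝ) × ℝ => (q.1.2, x)) (by fun_prop)
      have h2 : Continuous fun q : (ℝ × ℝ) × ℝ => β q.1.2 q.1.1 :=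
        hc.comp (f := fun q : (ℝ × ℝ) × ℝ => (q.1.2, q.1.1)) (by fun_prop)
      exact hbc.comp (h1.add (continuous_snd.mul (h2.sub h1)))
    have hlim := hE.tendsto x
    have hval : Real.exp (∫ s in (0:ℝ)..t, ∫ r in (0:ℝ)..1,
        deriv b (β s x + r * (β s x - β s x))) = J t x := by
      simp only [sub_self, mul_zero, add_zero, intervalIntegral.integral_const, sub_zero, one_smul,
        hJ]
      rw [intervalIntegral.mul_integral_comp_mul_right (f := fun s => deriv b (β s x))]
      simp
    rw [hval] at hlim
    refine (hlim.mono_left nhdsWithin_le_nhds).congr' ?_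
    filter_upwards [self_mem_nhdsWithin] with y hy
    rw [slope_def_field,
      sub_eq_sub_mul_exp_of_hasDerivAt hb (fun t => hβ t y) (fun t => hβ t x) t, h0, h0,
      mul_div_cancel_left₀ _ (sub_ne_zero.2 hy)]
  have hD : Continuous (Function.uncurry J) → ∀ p : ℝ × ℝ, HasFDerivAt (Function.uncurry β)
      ((ContinuousLinearMap.toSpanSingleton ℝ (b (Function.uncurry β p))).coprod
        (ContinuousLinearMap.toSpanSingleton ℝ (Function.uncurry J p))) p := by
    intro hJc p
    have hL := (ContinuousLinearMap.toSpanSingletonCLE (𝕜 := ℝ) (E := ℝ)).continuous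
    exact (hasStrictFDerivAt_uncurry_coprod (𝕜 := ℝ)
      (f₁ := fun t x => ContinuousLinearMap.toSpanSingleton ℝ (b (β t x)))
      (f₂ := fun t x => ContinuousLinearMap.toSpanSingleton ℝ (J t x))
      (.of_forall fun v => (hβ v.1 v.2).hasFDerivAt) (.of_forall fun v => (hx v.1 v.2).hasFDerivAt)
      (hL.comp (hb.continuous.comp hc)).continuousAt (hL.comp hJc).continuousAt).hasFDerivAt
  rw [contDiff_infty]
  intro n
  induction n with
  | zero => exact contDiff_zero.2 hc
  | succ n ih =>
    have hD := hD (hJn n ih).continuous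
    rw [Nat.cast_succ, contDiff_succ_iff_fderiv_apply]
    refine ⟨fun p => (hD p).differentiableAt, by simp, fun y => ?_⟩
    simp_rw [fun p => (hD p).fderiv]
    simp only [ContinuousLinearMap.coprod_apply, ContinuousLinearMap.toSpanSingleton_apply]
    have h1 : ContDiff ℝ n fun p => b (Function.uncurry β p) :=
      (hb.of_le (mod_cast le_top)).comp ih
    exact (contDiff_const.mul h1).add (contDiff_const.mul (hJn n ih))

theorem lineFlow_add {b : ℝ → ℝ} (hb : ContDiff ℝ ∞ b) (hs : HasCompactSupport b)
    {β : ℝ → ℝ → ℝ} (h0 : ∀ x, β 0 x = x) (hβ : ∀ t x, HasDerivAt (fun t => β t x) (b (β t x)) t)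
    (s t x : ℝ) : β s (β t x) = β (s + t) x := by
  have := lineFlow_unique hb hs (f := fun s => β s (β t x)) (g := fun s => β (s + t) x) (t₀ := 0)
    (fun s => hβ s _) (fun s => (hβ (s + t) x).comp_add_const s t) (by simp [h0])
  exact congrFun this s

/-! ### Explicit flows in a normed space -/

/-- `Ψ` is a one-parameter group of smooth maps of `E`, generated by the smooth vector field `X`,
and both are trivial outside `K`: the field vanishes and the maps fix every point there. -/
structure IsSmoothFlowSupportedIn {E : Type*} [NormedAddCommGroup E] [NormedSpace ℝ E]
    (Ψ : ℝ → E → E) (X : E → E) (K : Set E) : Prop where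
  contDiff_field : ContDiff ℝ ∞ X
  field_eq_zero : ∀ z, z ∉ K → X z = 0
  contDiff_flow : ∀ t, ContDiff ℝ ∞ (Ψ t)
  map_zero : ∀ z, Ψ 0 z = z
  map_map : ∀ s t z, Ψ s (Ψ t z) = Ψ (s + t) z
  map_eq_self : ∀ t z, z ∉ K → Ψ t z = z
  hasDerivAt : ∀ t z, HasDerivAt (fun t => Ψ t z) (X (Ψ t z)) t

namespace IsSmoothFlowSupportedIn

variable {E : Type*} [NormedAddCommGroup E] [NormedSpace ℝ E]
    {Ψ : ℝ → E → E} {X : E → E} {K : Set E}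

theorem neg (h : IsSmoothFlowSupportedIn Ψ X K) :
    IsSmoothFlowSupportedIn (fun t => Ψ (-t)) (fun z => -X z) K where
  contDiff_field := h.contDiff_field.neg
  field_eq_zero z hz := by simp [h.field_eq_zero z hz]
  contDiff_flow t := h.contDiff_flow (-t)
  map_zero z := by simp [h.map_zero]
  map_map s t z := by rw [h.map_map, neg_add]
  map_eq_self t z hz := h.map_eq_self (-t) z hz
  hasDerivAt t z := by
    have h1 := (h.hasDerivAt (-t) z).scomp t (hasDerivAt_neg t)
    rw [neg_one_smul] at h1
    exact h1

theorem neg_map_map (h : IsSmoothFlowSupportedIn Ψ X K) (t : ℝ) (z : E) :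
    Ψ (-t) (Ψ t z) = z := by
  rw [h.map_map, neg_add_cancel, h.map_zero]

/-- A set containing the support is invariant: the maps are bijective and fix its complement. -/
theorem map_mem_iff (h : IsSmoothFlowSupportedIn Ψ X K) {O : Set E} (hO : K ⊆ O) {t : ℝ} {z : E} :
    Ψ t z ∈ O ↔ z ∈ O := by
  by_cases hz : z ∈ K
  · refine iff_of_true ?_ (hO hz)
    by_contra hn
    have h1 := h.map_eq_self (-t) (Ψ t z) fun hK => hn (hO hK)
    rw [h.neg_map_map] at h1
    exact hn (h1 ▸ hO hz)
  · rw [h.map_eq_self t z hz]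

end IsSmoothFlowSupportedIn

/-- Where the field is the constant `1`, its flow is translation. -/
theorem lineFlow_zero_eq {b : ℝ → ℝ} (hb : ContDiff ℝ ∞ b) (hs : HasCompactSupport b) {ε : ℝ}
    (hε : 0 < ε) (hb1 : ∀ s ∈ Set.Ioo (-ε) ε, b s = 1) {f : ℝ → ℝ} (h0 : f 0 = 0)
    (hf : ∀ t, HasDerivAt f (b (f t)) t) {t : ℝ} (ht : t ∈ Set.Ioo (-ε) ε) : f t = t := by
  obtain ⟨K, hK⟩ := hb.lipschitzWith_of_hasCompactSupport hs (by simp)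
  have := ODE_solution_unique_of_mem_Ioo (v := fun _ => b) (s := fun _ => Set.univ) (K := K)
    (f := f) (g := id) (t₀ := 0) (a := -ε) (b := ε)
    (fun _ _ => hK.lipschitzOnWith) (by simpa using hε) (fun t _ => ⟨hf t, trivial⟩)
    (fun t ht => ⟨by simpa [hb1 t ht] using hasDerivAt_id t, trivial⟩) (by simp [h0])
  exact this ht

/-- The flow moves points along lines parallel to `z₁ - z₀`, by one fixed flow on the line,
with time rescaled by a bump function of the transversal coordinate. -/
theorem exists_smoothFlow_map_eq {E : Type*} [NormedAddCommGroup E] [NormedSpace ℝ E]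
    [FiniteDimensional ℝ E] {z₀ z₁ : E} {ε : ℝ} (hε : 0 < ε) (hz : dist z₁ z₀ < 2 * ε) :
    ∃ (Ψ : ℝ → E → E) (X : E → E),
      IsSmoothFlowSupportedIn Ψ X (Metric.closedBall z₀ (6 * ε)) ∧ Ψ 1 z₀ = z₁ := by
  rcases eq_or_ne z₁ z₀ with rfl | hne
  · exact ⟨fun _ z => z, fun _ => 0, ⟨contDiff_const, fun _ _ => rfl, fun _ => contDiff_id,
      fun _ => rfl, fun _ _ _ => rfl, fun _ _ _ => rfl, fun t z => hasDerivAt_const t z⟩, rfl⟩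
  set τ : ℝ := ‖z₁ - z₀‖
  have hτ : τ ≠ 0 := norm_ne_zero_iff.2 (sub_ne_zero.2 hne)
  obtain ⟨l, hl, hlv⟩ := exists_dual_vector ℝ (z₁ - z₀) hτ
  set u : E := τ⁻¹ • (z₁ - z₀)
  have hu : ‖u‖ = 1 := by simp [u, norm_smul, τ, inv_mul_cancel₀ hτ]
  have hlu : l u = 1 := by simp [u, hlv, τ, inv_mul_cancel₀ hτ]
  let f : ContDiffBump (0 : E) := ⟨2 * ε, 3 * ε, by linarith, by linarith⟩
  let b : ContDiffBump (0 : ℝ) := ⟨2 * ε, 3 * ε, by linarith, by linarith⟩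
  obtain ⟨β, hβ0, hβ⟩ := exists_lineFlow b.contDiff b.hasCompactSupport
  have hβs : ContDiff ℝ ∞ (Function.uncurry β) :=
    lineFlow_contDiff b.contDiff b.hasCompactSupport hβ0 hβ
  -- `s` and `w` are the coordinates along `u` and transversal to it, centred at `z₀`.
  set s : E → ℝ := fun z => l (z - z₀) with hs
  set w : E → E := fun z => z - z₀ - s z • u with hw
  have hs_smooth : ContDiff ℝ ∞ s := l.contDiff.comp (contDiff_id.sub contDiff_const)
  have hw_smooth : ContDiff ℝ ∞ w :=
    (contDiff_id.sub contDiff_const).sub (hs_smooth.smul contDiff_const)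
  have hlw : ∀ z, l (w z) = 0 := by
    intro z
    simp [hw, hs, hlu]
  set Ψ : ℝ → E → E := fun t z => z₀ + w z + β (t * (τ * f (w z))) (s z) • u with hΨ
  have hsΨ : ∀ t z, s (Ψ t z) = β (t * (τ * f (w z))) (s z) := by
    intro t z
    have : Ψ t z - z₀ = w z + β (t * (τ * f (w z))) (s z) • u := by simp only [hΨ]; abel
    simp only [hs, this, map_add, hlw, map_smul, hlu, smul_eq_mul, mul_one, zero_add]
  have hwΨ : ∀ t z, w (Ψ t z) = w z := by
    intro t z
    have : w (Ψ t z) = Ψ t z - z₀ - s (Ψ t z) • u := rfl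
    rw [this, hsΨ]
    simp only [hΨ]
    abel
  have hself : ∀ z, z₀ + w z + s z • u = z := fun z => by simp only [hw]; abel
  have hfb : ∀ z, z ∉ Metric.closedBall z₀ (6 * ε) → f (w z) = 0 ∨ b (s z) = 0 := by
    intro z hz
    by_contra! hc
    have h1 : w z ∈ Metric.ball 0 (3 * ε) := f.support_eq ▸ hc.1
    have h2 : s z ∈ Metric.ball 0 (3 * ε) := b.support_eq ▸ hc.2
    rw [mem_ball_zero_iff] at h1 h2
    refine hz ?_
    rw [mem_closedBall_iff_norm]
    calc ‖z - z₀‖ = ‖w z + s z • u‖ := by simp [hw]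
      _ ≤ ‖w z‖ + ‖s z‖ * ‖u‖ := (norm_add_le _ _).trans (by rw [norm_smul])
      _ ≤ 6 * ε := by rw [hu]; linarith
  refine ⟨Ψ, fun z => (τ * f (w z) * b (s z)) • u, ⟨?_, ?_, ?_, ?_, ?_, ?_, ?_⟩, ?_⟩
  · exact ((contDiff_const.mul (f.contDiff.comp hw_smooth)).mul
      (b.contDiff.comp hs_smooth)).smul contDiff_const
  · intro z hz
    rcases hfb z hz with h | h <;> simp [h]
  · intro t
    refine (contDiff_const.add hw_smooth).add (ContDiff.smul ?_ contDiff_const)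
    exact hβs.comp ((contDiff_const.mul (contDiff_const.mul (f.contDiff.comp hw_smooth))).prodMk
      hs_smooth)
  · intro z
    simp [hΨ, hβ0, hself]
  · intro t t' z
    have : Ψ t (Ψ t' z) = z₀ + w (Ψ t' z) + β (t * (τ * f (w (Ψ t' z)))) (s (Ψ t' z)) • u := rfl
    rw [this, hwΨ, hsΨ, lineFlow_add b.contDiff b.hasCompactSupport hβ0 hβ, ← add_mul]
  · intro t z hz
    rcases hfb z hz with h | h
    · simp [hΨ, h, hβ0, hself]
    -- A zero of `b` is a stationary point of `β`.
    · have : (fun t => β t (s z)) = fun _ => s z := by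
        refine lineFlow_unique b.contDiff b.hasCompactSupport (t₀ := 0) (fun t => hβ t _)
          (fun t => ?_) (hβ0 _)
        rw [h]
        exact hasDerivAt_const t _
      have h2 := congrFun this (t * (τ * f (w z)))
      simp only [hΨ] at h2 ⊢
      rw [h2, hself]
  · intro t z
    rw [hwΨ, hsΨ]
    have h1 : HasDerivAt (fun t => t * (τ * f (w z))) (τ * f (w z)) t := by
      simpa using (hasDerivAt_id t).mul_const (τ * f (w z))
    have h2 := ((hβ (t * (τ * f (w z))) (s z)).comp t h1)
    have h3 := (h2.smul_const u).const_add (z₀ + w z)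
    rw [mul_comm]
    exact h3
  · have hs0 : s z₀ = 0 := by simp [hs]
    have hw0 : w z₀ = 0 := by simp [hw, hs0]
    have hτ2 : τ < 2 * ε := by rwa [dist_eq_norm] at hz
    have hβτ : β τ 0 = τ := by
      refine lineFlow_zero_eq b.contDiff b.hasCompactSupport (ε := 2 * ε) (by linarith) ?_
        (f := fun t => β t 0) (hβ0 0) (fun t => hβ t 0) ⟨?_, hτ2⟩
      · intro s hs
        refine b.one_of_mem_closedBall ?_
        rw [mem_closedBall_zero_iff]
        exact abs_le.2 ⟨hs.1.le, hs.2.le⟩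
      · have := norm_nonneg (z₁ - z₀)
        change -(2 * ε) < ‖z₁ - z₀‖
        linarith
    have hf0 : f 0 = 1 := f.one_of_mem_closedBall (by simp [f, hε.le])
    simp only [hΨ, hw0, hs0, hf0, mul_one, one_mul, hβτ, add_zero]
    simp [u, smul_smul, mul_inv_cancel₀ hτ]

/-! ### Transport to a manifold -/

section Transport

variable {E : Type*} [NormedAddCommGroup E] {M : Type*} [TopologicalSpace M]
    {e : OpenPartialHomeomorph M E} {Ψ : ℝ → E → E} {X : E → E} {K : Set E}

open Classical in
/-- The maps `Ψ t` read in the chart `e`, extended by the identity off its source. -/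
noncomputable def flowViaChart (e : OpenPartialHomeomorph M E) (Ψ : ℝ → E → E) (t : ℝ)
    (m : M) : M :=
  if m ∈ e.source then e.symm (Ψ t (e m)) else m

theorem flowViaChart_of_mem {t : ℝ} {m : M} (hm : m ∈ e.source) :
    flowViaChart e Ψ t m = e.symm (Ψ t (e m)) := if_pos hm

theorem flowViaChart_of_notMem {t : ℝ} {m : M} (hm : m ∉ e.source) :
    flowViaChart e Ψ t m = m := if_neg hm

theorem mem_symm_image_iff (hK : K ⊆ e.target) {m : M} :
    m ∈ e.symm '' K ↔ m ∈ e.source ∧ e m ∈ K := by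
  constructor
  · rintro ⟨z, hz, rfl⟩
    exact ⟨e.map_target (hK hz), by rwa [e.right_inv (hK hz)]⟩
  · rintro ⟨h1, h2⟩
    exact ⟨e m, h2, e.left_inv h1⟩

variable [NormedSpace ℝ E]

theorem flowViaChart_eq_self (hΨ : IsSmoothFlowSupportedIn Ψ X K) (hK : K ⊆ e.target) {t : ℝ}
    {m : M} (hm : m ∉ e.symm '' K) : flowViaChart e Ψ t m = m := by
  by_cases h : m ∈ e.source
  · rw [flowViaChart_of_mem h, hΨ.map_eq_self, e.left_inv h]
    exact fun hz => hm ((mem_symm_image_iff hK).2 ⟨h, hz⟩)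
  · exact flowViaChart_of_notMem h

theorem flowViaChart_neg_flowViaChart (hΨ : IsSmoothFlowSupportedIn Ψ X K) (hK : K ⊆ e.target)
    (t : ℝ) (m : M) : flowViaChart e Ψ (-t) (flowViaChart e Ψ t m) = m := by
  by_cases h : m ∈ e.source
  · have hz : Ψ t (e m) ∈ e.target := (hΨ.map_mem_iff hK).2 (e.map_source h)
    rw [flowViaChart_of_mem h, flowViaChart_of_mem (e.map_target hz), e.right_inv hz,
      hΨ.neg_map_map, e.left_inv h]
  · rw [flowViaChart_of_notMem h, flowViaChart_of_notMem h]

variable [ChartedSpace E M]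

open Classical in
/-- The pullback of the vector field `X` by the chart `e`, extended by zero off its source. -/
noncomputable def fieldViaChart [IsManifold 𝓘(ℝ, E) ∞ M] (e : OpenPartialHomeomorph M E)
    (X : E → E) (m : M) : TangentSpace 𝓘(ℝ, E) m :=
  if m ∈ e.source then (mfderiv 𝓘(ℝ, E) 𝓘(ℝ, E) e m).inverse (X (e m)) else 0

theorem flowViaChart_contMDiff [T2Space M] [IsManifold 𝓘(ℝ, E) ∞ M] (he : e ∈ atlas E M)
    (hΨ : IsSmoothFlowSupportedIn Ψ X K) (hKc : IsCompact K) (hK : K ⊆ e.target) (t : ℝ) :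
    ContMDiff 𝓘(ℝ, E) 𝓘(ℝ, E) ∞ (flowViaChart e Ψ t) := by
  intro m
  have hmax := IsManifold.subset_maximalAtlas (I := 𝓘(ℝ, E)) (n := ∞) he
  by_cases h : m ∈ e.source
  · have h1 : ContMDiffAt 𝓘(ℝ, E) 𝓘(ℝ, E) ∞ (fun m => e.symm (Ψ t (e m))) m := by
      have hz : Ψ t (e m) ∈ e.target := (hΨ.map_mem_iff hK).2 (e.map_source h)
      exact (contMDiffAt_symm_of_mem_maximalAtlas hmax hz).comp m
        ((hΨ.contDiff_flow t).contMDiff.contMDiffAt.comp m (contMDiffAt_of_mem_maximalAtlas hmax h))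
    refine h1.congr_of_eventuallyEq ?_
    filter_upwards [e.open_source.mem_nhds h] with x hx using flowViaChart_of_mem hx
  · refine contMDiffAt_id.congr_of_eventuallyEq ?_
    have hcl : IsClosed (e.symm '' K) := (hKc.image_of_continuousOn
      (e.continuousOn_symm.mono hK)).isClosed
    have hm : m ∉ e.symm '' K := fun hm => h ((mem_symm_image_iff hK).1 hm).1
    filter_upwards [hcl.isOpen_compl.mem_nhds hm] with x hx using flowViaChart_eq_self hΨ hK hx

theorem fieldViaChart_symm [IsManifold 𝓘(ℝ, E) ∞ M] (hd : e.MDifferentiable 𝓘(ℝ, E) 𝓘(ℝ, E))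
    {z : E} (hz : z ∈ e.target) :
    (fieldViaChart e X (e.symm z) : E) =
      (mfderiv 𝓘(ℝ, E) 𝓘(ℝ, E) e.symm z : E →L[ℝ] E) (X z) := by
  have : IsManifold 𝓘(ℝ, E) 1 M := .of_le (n := ∞) (by simp)
  set A : E →L[ℝ] E := mfderiv 𝓘(ℝ, E) 𝓘(ℝ, E) e (e.symm z)
  set B : E →L[ℝ] E := mfderiv 𝓘(ℝ, E) 𝓘(ℝ, E) e.symm z
  have h3 : A.comp B = ContinuousLinearMap.id ℝ E := hd.comp_symm_deriv hz
  have h4 : B.comp A = ContinuousLinearMap.id ℝ E := by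
    have h4 := hd.symm_comp_deriv (e.map_target hz)
    rw [e.right_inv hz] at h4
    exact h4
  have h5 : (fieldViaChart e X (e.symm z) : E) = A.inverse (X (e (e.symm z))) :=
    if_pos (e.map_target hz)
  rw [h5, ContinuousLinearMap.inverse_eq h3 h4, e.right_inv hz]
  rfl

theorem flowViaChart_isFlowOf [IsManifold 𝓘(ℝ, E) ∞ M] (he : e ∈ atlas E M)
    (hΨ : IsSmoothFlowSupportedIn Ψ X K) (hK : K ⊆ e.target) :
    IsFlowOf (flowViaChart e Ψ) (fieldViaChart e X) where
  map_zero m := by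
    by_cases h : m ∈ e.source
    · rw [flowViaChart_of_mem h, hΨ.map_zero, e.left_inv h]
    · exact flowViaChart_of_notMem h
  isMIntegralCurve m := by
    by_cases h : m ∈ e.source
    · intro t
      have : IsManifold 𝓘(ℝ, E) 1 M := .of_le (n := ∞) (by simp)
      have hd : e.MDifferentiable 𝓘(ℝ, E) 𝓘(ℝ, E) := mdifferentiable_of_mem_atlas he
      have hz : Ψ t (e m) ∈ e.target := (hΨ.map_mem_iff hK).2 (e.map_source h)
      have hc : (fun t => flowViaChart e Ψ t m) = e.symm ∘ fun t => Ψ t (e m) := by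
        ext t
        exact flowViaChart_of_mem h
      have h1 := (hd.mdifferentiableAt_symm hz).hasMFDerivAt
      have h2 : HasMFDerivAt 𝓘(ℝ, ℝ) 𝓘(ℝ, E) (fun t => Ψ t (e m)) t
        ((1 : ℝ →L[ℝ] ℝ).smulRight (X (Ψ t (e m)))) :=
        (hΨ.hasDerivAt t (e m)).hasFDerivAt.hasMFDerivAt
      rw [hc]
      have hX : (1 : ℝ →L[ℝ] ℝ).smulRight (fieldViaChart e X (e.symm (Ψ t (e m))) : E) =
          (mfderiv 𝓘(ℝ, E) 𝓘(ℝ, E) e.symm (Ψ t (e m)) : E →L[ℝ] E).comp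
            ((1 : ℝ →L[ℝ] ℝ).smulRight (X (Ψ t (e m)))) := by
        have key : ∀ (B : E →L[ℝ] E) (v : E), (1 : ℝ →L[ℝ] ℝ).smulRight (B v) =
            B.comp ((1 : ℝ →L[ℝ] ℝ).smulRight v) := by
          intro B v
          ext
          simp
        rw [fieldViaChart_symm hd hz]
        exact key _ _
      exact (h1.comp t h2).congr_mfderiv hX.symm
    · have hc : (fun t => flowViaChart e Ψ t m) = fun _ => m := by
        ext t
        exact flowViaChart_of_notMem h
      rw [hc]
      exact isMIntegralCurve_const (if_neg h)

theorem fieldViaChart_eq_zero [IsManifold 𝓘(ℝ, E) ∞ M]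
    (hΨ : IsSmoothFlowSupportedIn Ψ X K) (hK : K ⊆ e.target) {m : M} (hm : m ∉ e.symm '' K) :
    fieldViaChart e X m = 0 := by
  by_cases h : m ∈ e.source
  · have hz : e m ∉ K := fun hz => hm ((mem_symm_image_iff hK).2 ⟨h, hz⟩)
    rw [fieldViaChart, if_pos h, hΨ.field_eq_zero _ hz]
    exact _root_.map_zero _
  · exact if_neg h

theorem fieldViaChart_isSmoothCompactlySupportedIn [T2Space M] [FiniteDimensional ℝ E]
    [IsManifold 𝓘(ℝ, E) ∞ M]
    (he : e ∈ atlas E M) (hΨ : IsSmoothFlowSupportedIn Ψ X K) (hKc : IsCompact K)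
    (hK : K ⊆ e.target) {U : Set M} (hU : e.symm '' K ⊆ U) :
    IsSmoothCompactlySupportedIn (fieldViaChart e X) U := by
  have hKM : IsCompact (e.symm '' K) := hKc.image_of_continuousOn (e.continuousOn_symm.mono hK)
  have hsub : closure {p : M | fieldViaChart e X p ≠ 0} ⊆ e.symm '' K := by
    refine closure_minimal (fun p hp => ?_) hKM.isClosed
    by_contra hn
    exact hp (fieldViaChart_eq_zero hΨ hK hn)
  refine ⟨fun m => ?_, hKM.of_isClosed_subset isClosed_closure hsub, hsub.trans hU⟩
  by_cases h : m ∈ e.source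
  · have hmax := IsManifold.subset_maximalAtlas (I := 𝓘(ℝ, E)) (n := ∞) he
    have hd : e.MDifferentiable 𝓘(ℝ, E) 𝓘(ℝ, E) := mdifferentiable_of_mem_atlas he
    have hXs : ContMDiff 𝓘(ℝ, E) 𝓘(ℝ, E).tangent ∞
        (fun z => (⟨z, X z⟩ : TangentBundle 𝓘(ℝ, E) E)) :=
      contMDiff_vectorSpace_iff_contDiff.2 hΨ.contDiff_field
    have h1 := ContMDiffAt.mpullback_vectorField_preimage (f := e) (x₀ := m) (n := ∞) (m := ∞)
      hXs.contMDiffAt (contMDiffAt_of_mem_maximalAtlas hmax h)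
      ⟨hd.mfderiv h, rfl⟩ le_rfl
    refine h1.congr_of_eventuallyEq ?_
    filter_upwards [e.open_source.mem_nhds h] with x hx
    rw [fieldViaChart, if_pos hx]
    rfl
  · have hm : m ∉ e.symm '' K := fun hm => h ((mem_symm_image_iff hK).1 hm).1
    have h0 := (Bundle.contMDiff_zeroSection (n := ∞) (IB := 𝓘(ℝ, E)) (F := E) ℝ
      (TangentSpace 𝓘(ℝ, E) (M := M))).contMDiffAt (x := m)
    refine h0.congr_of_eventuallyEq ?_
    filter_upwards [hKM.isClosed.isOpen_compl.mem_nhds hm] with x hx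
    rw [fieldViaChart_eq_zero hΨ hK hx]
    rfl

end Transport

/-! ### Joining points of a connected open set -/

/-- Some smooth vector field with compact support in `U` has a global flow whose time-one map is a
diffeomorphism that fixes the complement of `U` and carries `p` to `q`. -/
def FlowMapsTo {E : Type*} [NormedAddCommGroup E] [NormedSpace ℝ E]
    {M : Type*} [TopologicalSpace M] [ChartedSpace E M] [IsManifold 𝓘(ℝ, E) ∞ M]
    (U : Set M) (p q : M) : Prop :=
  ∃ (X : (p : M) → TangentSpace 𝓘(ℝ, E) p) (φ : ℝ → M → M),
    IsSmoothCompactlySupportedIn X U ∧ IsFlowOf φ X ∧ φ 1 p = q ∧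
    ∃ Φ : Diffeomorph 𝓘(ℝ, E) 𝓘(ℝ, E) M M ∞, (∀ m, Φ m = φ 1 m) ∧ ∀ m, m ∉ U → Φ m = m

theorem IsSmoothFlowSupportedIn.flowMapsTo {E : Type*} [NormedAddCommGroup E] [NormedSpace ℝ E]
    [FiniteDimensional ℝ E] {M : Type*} [TopologicalSpace M] [ChartedSpace E M]
    [IsManifold 𝓘(ℝ, E) ∞ M] [T2Space M] {e : OpenPartialHomeomorph M E} (he : e ∈ atlas E M)
    {Ψ : ℝ → E → E} {X : E → E} {K : Set E} (hΨ : IsSmoothFlowSupportedIn Ψ X K)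
    (hKc : IsCompact K) (hK : K ⊆ e.target) {U : Set M} (hU : e.symm '' K ⊆ U)
    {p q : M} (hp : p ∈ e.source) (hq : q ∈ e.source) (hpq : Ψ 1 (e p) = e q) :
    FlowMapsTo (E := E) U p q := by
  refine ⟨fieldViaChart e X, flowViaChart e Ψ,
    fieldViaChart_isSmoothCompactlySupportedIn he hΨ hKc hK hU, flowViaChart_isFlowOf he hΨ hK,
    ?_, ⟨⟨flowViaChart e Ψ 1, flowViaChart e Ψ (-1), flowViaChart_neg_flowViaChart hΨ hK 1,
      fun m => ?_⟩, flowViaChart_contMDiff he hΨ hKc hK 1,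
        flowViaChart_contMDiff he hΨ hKc hK (-1)⟩,
      fun _ => rfl, fun m hm => flowViaChart_eq_self hΨ hK fun h => hm (hU h)⟩
  · rw [flowViaChart_of_mem hp, hpq, e.left_inv hq]
  · simpa using flowViaChart_neg_flowViaChart hΨ hK (-1) m

theorem eventually_flowMapsTo {E : Type*} [NormedAddCommGroup E] [NormedSpace ℝ E]
    [FiniteDimensional ℝ E] {M : Type*} [TopologicalSpace M] [ChartedSpace E M]
    [IsManifold 𝓘(ℝ, E) ∞ M] [T2Space M] {U : Set M} (hU : IsOpen U) {p : M} (hp : p ∈ U) :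
    ∀ᶠ q in nhds p, FlowMapsTo (E := E) U p q ∧ FlowMapsTo (E := E) U q p := by
  set e := chartAt E p
  have he : e ∈ atlas E M := chart_mem_atlas E p
  have hpe : p ∈ e.source := mem_chart_source E p
  have hO : IsOpen (e.target ∩ e.symm ⁻¹' U) := e.isOpen_inter_preimage_symm hU
  have hpO : e p ∈ e.target ∩ e.symm ⁻¹' U :=
    ⟨e.map_source hpe, by simpa [e.left_inv hpe] using hp⟩
  obtain ⟨r, hr, hrO⟩ := Metric.nhds_basis_closedBall.mem_iff.1 (hO.mem_nhds hpO)
  -- The flows joining `p` to points at distance less than `2 * ε` are supported in a ball of radius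
  -- `6 * ε`, which thus has to fit into the chart and into `U`.
  obtain ⟨ε, hε, rfl⟩ : ∃ ε > 0, 6 * ε = r := ⟨r / 6, by positivity, by ring⟩
  have hKU : e.symm '' Metric.closedBall (e p) (6 * ε) ⊆ U := by
    rintro _ ⟨z, hz, rfl⟩
    exact (hrO hz).2
  have hKt : Metric.closedBall (e p) (6 * ε) ⊆ e.target := fun z hz => (hrO hz).1
  filter_upwards [e.open_source.mem_nhds hpe,
    (e.continuousAt hpe).preimage_mem_nhds (Metric.ball_mem_nhds (e p) (by positivity : 0 < 2 * ε))]
    with q hq hqε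
  obtain ⟨Ψ, X, hΨ, hpq⟩ := exists_smoothFlow_map_eq hε hqε
  have := FiniteDimensional.proper_real E
  have hKc := isCompact_closedBall (e p) (6 * ε)
  refine ⟨hΨ.flowMapsTo he hKc hKt hKU hpe hq hpq, hΨ.neg.flowMapsTo he hKc hKt hKU hq hpe ?_⟩
  -- The reversed flow carries `q` back to `p`.
  rw [← hpq, hΨ.neg_map_map]

theorem exists_composeMaps_of_reflTransGen {E : Type*} [NormedAddCommGroup E] [NormedSpace ℝ E]
    {M : Type*} [TopologicalSpace M] [ChartedSpace E M] [IsManifold 𝓘(ℝ, E) ∞ M]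
    {U : Set M} {x y : M} (h : Relation.ReflTransGen (FlowMapsTo (E := E) U) x y) :
    ∃ (k : ℕ) (X : Fin k → (p : M) → TangentSpace 𝓘(ℝ, E) p) (φ : Fin k → ℝ → M → M),
      (∀ i, IsSmoothCompactlySupportedIn (X i) U) ∧
      (∀ i, IsFlowOf (φ i) (X i)) ∧
      composeMaps k (fun i => φ i 1) x = y ∧
      ∃ Φ : Diffeomorph 𝓘(ℝ, E) 𝓘(ℝ, E) M M ∞,
        (∀ m, Φ m = composeMaps k (fun i => φ i 1) m) ∧
        Φ x = y ∧ ∀ m, m ∉ U → Φ m = m := by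
  induction h with
  | refl =>
    exact ⟨0, fun i => i.elim0, fun i => i.elim0, fun i => i.elim0, fun i => i.elim0, rfl,
      Diffeomorph.refl _ _ _, fun _ => rfl, rfl, fun _ _ => rfl⟩
  | tail _ hstep ih =>
    obtain ⟨k, X, φ, hX, hφ, hxy, Φ, hΦ, hΦx, hΦU⟩ := ih
    obtain ⟨Y, ψ, hY, hψ, hyz, Θ, hΘ, hΘU⟩ := hstep
    have hcomp : ∀ m, composeMaps (k + 1) (fun i => Fin.snoc (α := fun _ => ℝ → M → M) φ ψ i 1) m =
        ψ 1 (composeMaps k (fun i => φ i 1) m) := by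
      intro m
      simp [composeMaps]
    refine ⟨k + 1, Fin.snoc (α := fun _ => (p : M) → TangentSpace 𝓘(ℝ, E) p) X Y,
      Fin.snoc (α := fun _ => ℝ → M → M) φ ψ, ?_, ?_, ?_, Φ.trans Θ, ?_, ?_, ?_⟩
    · exact Fin.lastCases (by simpa using hY) fun i => by simpa using hX i
    · exact Fin.lastCases (by simpa using hψ) fun i => by simpa using hφ i
    · rw [hcomp, hxy, hyz]
    · intro m
      rw [hcomp, ← hΦ, ← hΘ]
      rfl
    · rw [Diffeomorph.coe_trans, Function.comp_apply, hΦx, hΘ, hyz]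
    · intro m hm
      rw [Diffeomorph.coe_trans, Function.comp_apply, hΦU m hm, hΘU m hm]

theorem theorem3p4 {E : Type*} [NormedAddCommGroup E] [NormedSpace ℝ E] [FiniteDimensional ℝ E]
    {M : Type*} [TopologicalSpace M] [ChartedSpace E M] [IsManifold 𝓘(ℝ, E) ∞ M]
    [T2Space M] [ConnectedSpace M]
    (x y : M) (U : Set M) (hUo : IsOpen U) (hUc : IsConnected U) (hx : x ∈ U) (hy : y ∈ U) :
    ∃ (k : ℕ) (X : Fin k → (p : M) → TangentSpace 𝓘(ℝ, E) p) (φ : Fin k → ℝ → M → M),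
      (∀ i, IsSmoothCompactlySupportedIn (X i) U) ∧
      (∀ i, IsFlowOf (φ i) (X i)) ∧
      composeMaps k (fun i => φ i 1) x = y ∧
      ∃ Φ : Diffeomorph 𝓘(ℝ, E) 𝓘(ℝ, E) M M ∞,
        (∀ m, Φ m = composeMaps k (fun i => φ i 1) m) ∧
        Φ x = y ∧ ∀ m, m ∉ U → Φ m = m := by
  refine exists_composeMaps_of_reflTransGen
    (hUc.isPreconnected.induction₂' (Relation.ReflTransGen (FlowMapsTo (E := E) U)) ?_ ?_ hx hy)
  · intro p hp
    filter_upwards [mem_nhdsWithin_of_mem_nhds (eventually_flowMapsTo (E := E) hUo hp)] with q hq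
    exact ⟨.single hq.1, .single hq.2⟩
  · exact fun _ _ _ _ _ _ h₁ h₂ => h₁.trans h₂
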